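/- All graphs are finite and simple. A cubic graph here is a connected graph in which every vertex has degree $3$; it is bridgeless if no edge is a bridge. A perfect matching of a graph $G$ is a set of edges of $G$ such that every vertex is an end of exactly one of them. Two perfect matchings $M_1, M_2$ of $G$ (not necessarily distinct) form an $S_4$-pair of $G$ if deleting the edges of $M_1\cup M_2$ from $G$ leaves a bipartite graph. The frequency of an edge $a$ with respect to the pair, $\nu_G[a:M_1,M_2]\in\{0,1,2\}$, is the number of indices $t\in\{1,2\}$ with $a\in M_t$. Theorem. The following two statements are equivalent. (1) ($S_4$-Conjecture) Every bridgeless cubic graph has an $S_4$-pair. (2) For every bridgeless cubic graph $G$, every vertex $w$ of $G$, every ordering $(a,b,c)$ of the three edges incident to $w$, and all integers $i,j,k\in\{0,1,2\}$ with $i+j+k=2$, there is an $S_4$-pair $M_1,M_2$ of $G$ such that $\nu_G[a:M_1,M_2]=i$, $\nu_G[b:M_1,M_2]=j$ and $\nu_G[c:M_1,M_2]=k$. -/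

import Mathlib

universe u

namespace SimpleGraph

/-- A simple connected cubic graph without bridges. -/
structure IsBridgelessCubic {V : Type u} (G : SimpleGraph V) [G.LocallyFinite] : Prop where
  connected : G.Connected
  cubic : G.IsRegularOfDegree 3
  bridgeless : ∀ e ∈ G.edgeSet, ¬ G.IsBridge e

/-- Two perfect matchings (possibly equal) form an `S₄`-pair of `G` if deleting the edges of their
union from `G` leaves a bipartite graph. -/
structure IsS4Pair {V : Type u} {G : SimpleGraph V} (M₁ M₂ : G.Subgraph) : Prop where
  left : M₁.IsPerfectMatching
  right : M₂.IsPerfectMatching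
  bipartite : (G.deleteEdges (M₁.edgeSet ∪ M₂.edgeSet)).IsBipartite

open Classical in
/-- The frequency of an edge `a`: the number of times it occurs in the list `M₁, M₂`. -/
noncomputable def edgeFrequency {V : Type u} {G : SimpleGraph V} (M₁ M₂ : G.Subgraph)
    (a : Sym2 V) : ℕ :=
  (if a ∈ M₁.edgeSet then 1 else 0) + (if a ∈ M₂.edgeSet then 1 else 0)

/-- The `S₄`-Conjecture: every (finite) bridgeless cubic graph has an `S₄`-pair. -/
def S4Conjecture : Prop :=
  ∀ (V : Type u) [Finite V] (G : SimpleGraph V) [G.LocallyFinite], G.IsBridgelessCubic →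
    ∃ M₁ M₂ : G.Subgraph, IsS4Pair M₁ M₂

/-- In every (finite) bridgeless cubic graph the frequencies, with respect to an `S₄`-pair, of the
three edges `a, b, c` at a vertex `w`, listed in any order, can be prescribed to be any `(i, j, k)`
with `i, j, k ∈ {0, 1, 2}` and `i + j + k = 2`. -/
def S4VertexFrequencyConjecture : Prop :=
  ∀ (V : Type u) [Finite V] (G : SimpleGraph V) [G.LocallyFinite], G.IsBridgelessCubic →
    ∀ (w : V) (a b c : Sym2 V),
      a ∈ G.incidenceSet w → b ∈ G.incidenceSet w → c ∈ G.incidenceSet w →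
      a ≠ b → a ≠ c → b ≠ c →
    ∀ i ∈ ({0, 1, 2} : Set ℕ), ∀ j ∈ ({0, 1, 2} : Set ℕ), ∀ k ∈ ({0, 1, 2} : Set ℕ),
      i + j + k = 2 →
      ∃ M₁ M₂ : G.Subgraph, IsS4Pair M₁ M₂ ∧
        edgeFrequency M₁ M₂ a = i ∧ edgeFrequency M₁ M₂ b = j ∧ edgeFrequency M₁ M₂ c = k

end SimpleGraph

/-!
The nontrivial direction derives the prescribed frequencies from the `S₄`-Conjecture. As they sum to
two at `w`, it suffices to find an `S₄`-pair with a given edge in both matchings, and one with two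
given edges at `w` in one matching each.

*A given edge in both matchings* (`exists_isS4MapPair_inter`). If no `S₄`-pair of `G` has `pq` in
both matchings, then `G` without `pq`, inserted into an edge `xy` of a graph `H` (a two-sum), keeps
that edge out of the intersection of the two matchings of an `S₄`-pair. By parity, a perfect matching
of the two-sum uses both or none of the two edges between the summands, so it induces perfect
matchings of `H` and of `G`, and the one contains `xy` if and only if the other contains `pq`.
Inserting copies of `G` one by one into all edges of the Petersen graph would yield two disjoint
perfect matchings of it, and there are none. The induction (`exists_isS4MapPair_avoiding`) gives up
the odd cycles through the edges of `H` that receive a copy of `G`; this is harmless, as the odd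
cycles inside the copies stay covered.

*Two given edges at `w`* (`exists_isS4MapPair_separate`). Expand `w` to the Petersen graph without a
vertex, such that the third edge at `w` is still attached to `w`, and take an `S₄`-pair of the result
with an edge from `w` to the gadget in both matchings. Then neither matching contains the third edge,
and each leaves the gadget through just one of the two given edges. If both did so through the same
one, they would agree on the gadget and leave a 5-cycle uncovered
(`IsS4MapPair.petersenExpansion_cases`).

Throughout, a perfect matching is described by the involution that maps each vertex to its partner.
-/

namespace SimpleGraph

/-! ### Two-edge-connected cubic graphs -/

/-- A cubic graph that stays connected after deleting any one edge. -/
structure IsTwoEdgeConnectedCubic {V : Type*} (G : SimpleGraph V) : Prop where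
  nonempty : Nonempty V
  preconnected_deleteEdges : ∀ e, (G.deleteEdges {e}).Preconnected
  ncard_neighborSet : ∀ v, (G.neighborSet v).ncard = 3

lemma Reachable.lift {V W : Type*} {G : SimpleGraph V} {K : SimpleGraph W} (φ : V → W)
    (h : ∀ a b, G.Adj a b → K.Reachable (φ a) (φ b)) {a b : V} (hab : G.Reachable a b) :
    K.Reachable (φ a) (φ b) := by
  rw [reachable_iff_reflTransGen] at hab
  induction hab with
  | refl => rfl
  | tail _ hbc ih => exact ih.trans (h _ _ hbc)

lemma ncard_neighborSet_eq_degree {V : Type*} (G : SimpleGraph V) [G.LocallyFinite] (v : V) :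
    (G.neighborSet v).ncard = G.degree v := by
  rw [← card_neighborSet_eq_degree, ← Nat.card_coe_set_eq, Nat.card_eq_fintype_card]

lemma isBridgelessCubic_iff {V : Type u} (G : SimpleGraph V) [G.LocallyFinite] :
    G.IsBridgelessCubic ↔ G.IsTwoEdgeConnectedCubic := by
  constructor
  · rintro ⟨hc, h3, hb⟩
    refine ⟨hc.nonempty, fun e a b => ?_, fun v => by rw [ncard_neighborSet_eq_degree]; exact h3 v⟩
    refine Reachable.lift id (fun a b hab => ?_) (hc.preconnected a b)
    by_cases he : s(a, b) = e
    · have := hb s(a, b) hab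
      rw [isBridge_iff, not_not] at this
      exact he ▸ this
    · exact Adj.reachable (by simp [hab, he])
  · rintro ⟨hne, hc, h3⟩
    refine ⟨?_, fun v => by rw [← ncard_neighborSet_eq_degree]; exact h3 v, fun e he hb => ?_⟩
    · exact ⟨fun a b => (hc s(a, b) a b).mono (deleteEdges_le _)⟩
    · induction e with
      | _ a b => exact (isBridge_iff.1 hb) (hc _ a b)

/-- Deleting one edge from a closed trail leaves its vertices connected. The trail is given by the
sequence `c` of its vertices. -/
lemma reachable_deleteEdges_of_closed_trail {V : Type*} {K : SimpleGraph V} {n : ℕ} (c : ℕ → V)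
    (hadj : ∀ i < n, K.Adj (c i) (c (i + 1))) (hclosed : c n = c 0)
    (hinj : ∀ i < n, ∀ j < n, s(c i, c (i + 1)) = s(c j, c (j + 1)) → i = j)
    (e : Sym2 V) {i : ℕ} (hi : i ≤ n) : (K.deleteEdges {e}).Reachable (c 0) (c i) := by
  have seg : ∀ i j, i ≤ j → j ≤ n → (∀ k, i ≤ k → k < j → s(c k, c (k + 1)) ≠ e) →
      (K.deleteEdges {e}).Reachable (c i) (c j) := by
    intro i j hij
    induction j, hij using Nat.le_induction with
    | base => intros; rfl
    | succ j hij ih =>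
      intro hj hk
      refine (ih (by omega) fun k h1 h2 => hk k h1 (by omega)).trans (Adj.reachable ?_)
      simp [hadj j (by omega), hk j hij (by omega)]
  by_cases h : ∀ k < i, s(c k, c (k + 1)) ≠ e
  · exact seg 0 i (by omega) hi fun k _ hk => h k hk
  · push Not at h
    obtain ⟨k, hk, rfl⟩ := h
    rw [← hclosed]
    exact (seg i n hi le_rfl fun l h1 h2 h3 => by
      have := hinj l h2 k (by omega) h3
      omega).symm

/-! ### Perfect matchings as involutions -/

/-- The map `m` sends each vertex to its partner in a perfect matching of `G`. -/
structure IsMatchingMap {V : Type*} (G : SimpleGraph V) (m : V → V) : Prop where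
  adj : ∀ v, G.Adj v (m v)
  involutive : Function.Involutive m

/-- The perfect matchings given by `m₁` and `m₂` have a union that, together with the set `S` of
further edges, meets every odd cycle of `G`: the remaining graph has a proper 2-colouring. For
`S = ∅` this says that the two matchings form an `S₄`-pair. -/
structure IsS4MapPair {V : Type*} (G : SimpleGraph V) (S : Set (Sym2 V)) (m₁ m₂ : V → V) :
    Prop where
  left : G.IsMatchingMap m₁
  right : G.IsMatchingMap m₂
  bipartite : ∃ c : V → Bool, ∀ u v, G.Adj u v → m₁ u ≠ v → m₂ u ≠ v → s(u, v) ∉ S → c u ≠ c v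

lemma IsMatchingMap.eq_comm {V : Type*} {G : SimpleGraph V} {m : V → V} (hm : G.IsMatchingMap m)
    {u v : V} : m u = v ↔ m v = u :=
  ⟨fun h => h ▸ hm.involutive u, fun h => h ▸ hm.involutive v⟩

/-- The spanning subgraph whose edges join each vertex to its partner. -/
def IsMatchingMap.subgraph {V : Type*} {G : SimpleGraph V} {m : V → V} (hm : G.IsMatchingMap m) :
    G.Subgraph where
  verts := Set.univ
  Adj u v := m u = v
  adj_sub := by rintro u _ rfl; exact hm.adj u
  edge_vert _ := Set.mem_univ _
  symm := ⟨fun _ _ h => hm.eq_comm.1 h⟩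

lemma IsMatchingMap.isPerfectMatching {V : Type*} {G : SimpleGraph V} {m : V → V}
    (hm : G.IsMatchingMap m) : hm.subgraph.IsPerfectMatching := by
  rw [Subgraph.isPerfectMatching_iff]
  exact fun v => ⟨m v, rfl, fun _ h => Eq.symm h⟩

lemma Subgraph.IsPerfectMatching.exists_map {V : Type*} {G : SimpleGraph V}
    {M : G.Subgraph} (hM : M.IsPerfectMatching) :
    ∃ m, G.IsMatchingMap m ∧ ∀ u v, M.Adj u v ↔ m u = v := by
  rw [Subgraph.isPerfectMatching_iff] at hM
  choose m hm hm' using hM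
  have key : ∀ u v, M.Adj u v ↔ m u = v := fun u v => ⟨fun h => (hm' u v h).symm, fun h => h ▸ hm u⟩
  exact ⟨m, ⟨fun v => (hm v).adj_sub, fun v => (key _ _).1 (hm v).symm⟩, key⟩

lemma isBipartite_iff_exists_bool {V : Type*} (G : SimpleGraph V) :
    G.IsBipartite ↔ ∃ c : V → Bool, ∀ u v, G.Adj u v → c u ≠ c v := by
  constructor
  · rintro ⟨c⟩
    refine ⟨fun v => decide (c v = 0), fun u v h => ?_⟩
    have := c.valid h
    simp only [ne_eq, decide_eq_decide]
    omega
  · rintro ⟨c, hc⟩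
    exact (Coloring.mk c fun {u v} h => hc u v h).colorable

lemma IsS4Pair.exists_maps {V : Type u} {G : SimpleGraph V} {M₁ M₂ : G.Subgraph}
    (h : IsS4Pair M₁ M₂) : ∃ m₁ m₂, G.IsS4MapPair ∅ m₁ m₂ := by
  obtain ⟨m₁, h₁, h₁'⟩ := h.left.exists_map
  obtain ⟨m₂, h₂, h₂'⟩ := h.right.exists_map
  obtain ⟨c, hc⟩ := (isBipartite_iff_exists_bool _).1 h.bipartite
  exact ⟨m₁, m₂, h₁, h₂, c, fun u v huv hu hv _ => hc u v (by simp [huv, h₁', h₂', hu, hv])⟩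

lemma IsS4MapPair.isS4Pair {V : Type u} {G : SimpleGraph V} {m₁ m₂ : V → V}
    (h : G.IsS4MapPair ∅ m₁ m₂) : IsS4Pair h.left.subgraph h.right.subgraph := by
  refine ⟨h.left.isPerfectMatching, h.right.isPerfectMatching, ?_⟩
  obtain ⟨c, hc⟩ := h.bipartite
  refine (isBipartite_iff_exists_bool _).2 ⟨c, fun u v huv => ?_⟩
  simp only [deleteEdges_adj, Set.mem_union, Subgraph.mem_edgeSet, IsMatchingMap.subgraph,
    not_or] at huv
  exact hc u v huv.1 huv.2.1 huv.2.2 (by simp)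

open Classical in
lemma IsS4MapPair.edgeFrequency {V : Type u} {G : SimpleGraph V} {m₁ m₂ : V → V}
    (h : G.IsS4MapPair ∅ m₁ m₂) (u v : V) :
    edgeFrequency h.left.subgraph h.right.subgraph s(u, v) =
      (if m₁ u = v then 1 else 0) + (if m₂ u = v then 1 else 0) := by
  simp [SimpleGraph.edgeFrequency, IsMatchingMap.subgraph]

lemma IsS4MapPair.symm {V : Type*} {G : SimpleGraph V} {S : Set (Sym2 V)} {m₁ m₂ : V → V}
    (h : G.IsS4MapPair S m₁ m₂) : G.IsS4MapPair S m₂ m₁ :=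
  ⟨h.right, h.left, h.bipartite.imp fun _ hc u v huv h₁ h₂ => hc u v huv h₂ h₁⟩

lemma even_card_iff_even_ncard_fixedPoints {V : Type*} [Finite V] {f : V → V}
    (hf : Function.Involutive f) : Even (Nat.card V) ↔ Even {v | f v = v}.ncard := by
  classical
  have := Fintype.ofFinite V
  let g : Function.End V := f
  have h2 : g ^ 2 ^ 1 = 1 := by
    rw [pow_one, pow_two]
    exact funext hf
  have := Fact.mk Nat.prime_two
  have h := Equiv.Perm.card_fixedPoints_modEq (p := 2) (n := 1) h2
  rw [← Nat.card_eq_fintype_card, ← Nat.card_eq_fintype_card, Nat.card_coe_set_eq] at h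
  rw [Nat.even_iff, Nat.even_iff]
  exact Eq.congr_left h

lemma IsMatchingMap.even_card {V : Type*} [Finite V] {G : SimpleGraph V} {m : V → V}
    (hm : G.IsMatchingMap m) : Even (Nat.card V) := by
  rw [even_card_iff_even_ncard_fixedPoints hm.involutive]
  have : {v | m v = v} = ∅ := by
    ext v
    simpa using (hm.adj v).ne'
  simp [this]

/-- Suppose that `X` contains a copy `ι` of `H` without the edge `xy`, and that a perfect matching
of `X` leaves this copy only at `x` and `y`. Since `H` has evenly many vertices, it does so at both
or at neither of them. Hence it induces a perfect matching of `H`, which uses the edge `xy` in the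
first case. -/
lemma exists_isMatchingMap_restrict {V X : Type*} [Finite V] {H : SimpleGraph V} {ι : V → X}
    (hι : Function.Injective ι) {m : X → X} (hm : Function.Involutive m) {x y : V}
    (hxy : H.Adj x y) (heven : Even (Nat.card V))
    (h : ∀ v, (∃ v', m (ι v) = ι v' ∧ H.Adj v v' ∧ s(v, v') ≠ s(x, y)) ∨
      (v = x ∨ v = y) ∧ m (ι v) ∉ Set.range ι) :
    ∃ m', H.IsMatchingMap m' ∧ (∀ u v, s(u, v) ≠ s(x, y) → (m' u = v ↔ m (ι u) = ι v)) ∧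
      (m' x = y ↔ m (ι x) ∉ Set.range ι) ∧ (m' x = y ↔ m (ι y) ∉ Set.range ι) := by
  classical
  let φ : V → V := fun v => Function.extend ι id (fun _ => v) (m (ι v))
  have hφ1 : ∀ v v', m (ι v) = ι v' → φ v = v' := fun v v' hv => by
    simp only [φ, hv, hι.extend_apply, id]
  have hφ2 : ∀ v, m (ι v) ∉ Set.range ι → φ v = v := fun v hv =>
    Function.extend_apply' _ _ _ hv
  have hinv : Function.Involutive φ := by
    intro v
    rcases h v with ⟨v', hv, _⟩ | ⟨_, hv⟩
    · rw [hφ1 v v' hv]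
      exact hφ1 _ _ (by rw [← hv, hm])
    · rw [hφ2 v hv, hφ2 v hv]
  have hfix : ∀ v, φ v = v ↔ m (ι v) ∉ Set.range ι := by
    intro v
    refine ⟨fun hv => ?_, hφ2 v⟩
    rcases h v with ⟨v', hv', hadj, _⟩ | ⟨_, hv'⟩
    · exact absurd ((hφ1 v v' hv').symm.trans hv) hadj.ne'
    · exact hv'
  have hsub : ∀ v, φ v = v → v = x ∨ v = y := by
    intro v hv
    rcases h v with ⟨v', hv', hadj, _⟩ | ⟨hv', _⟩
    · exact absurd ((hφ1 v v' hv').symm.trans hv) hadj.ne'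
    · exact hv'
  have hboth : φ x = x ↔ φ y = y := by
    have he := (even_card_iff_even_ncard_fixedPoints hinv).1 heven
    by_cases hx : φ x = x <;> by_cases hy : φ y = y <;> simp only [hx, hy]
    · have : {v | φ v = v} = {x} := by
        ext v
        exact ⟨fun hv => (hsub v hv).resolve_right (by rintro rfl; exact hy hv),
          by rintro rfl; exact hx⟩
      rw [this] at he
      simp at he
    · have : {v | φ v = v} = {y} := by
        ext v
        exact ⟨fun hv => (hsub v hv).resolve_left (by rintro rfl; exact hx hv),
          by rintro rfl; exact hy⟩
      rw [this] at he
      simp at he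
  have hin : ∀ v, φ v ≠ v → m (ι v) = ι (φ v) ∧ H.Adj v (φ v) ∧ s(v, φ v) ≠ s(x, y) := by
    intro v hv
    rcases h v with ⟨v', hv', h'⟩ | ⟨_, hv'⟩
    · rw [hφ1 v v' hv']
      exact ⟨hv', h'⟩
    · exact absurd (hφ2 v hv') hv
  by_cases hx : φ x = x
  · have hy := hboth.1 hx
    have hne := hxy.ne
    have hφx : ∀ v, φ v = x ↔ v = x := fun v =>
      ⟨fun e => hinv.injective (e.trans hx.symm), fun e => e ▸ hx⟩
    have hφy : ∀ v, φ v = y ↔ v = y := fun v =>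
      ⟨fun e => hinv.injective (e.trans hy.symm), fun e => e ▸ hy⟩
    obtain ⟨g, hg⟩ : ∃ g : V → V, ∀ v, g v = if v = x then y else if v = y then x else φ v :=
      ⟨_, fun _ => rfl⟩
    refine ⟨g, ⟨fun v => ?_, fun v => ?_⟩, fun u v huv => ?_, ?_, ?_⟩
    · rw [hg]
      split_ifs with h1 h2
      · exact h1 ▸ hxy
      · exact h2 ▸ hxy.symm
      · exact (hin v fun e => by rcases hsub v e with e | e <;> contradiction).2.1
    · rw [hg v]
      split_ifs with h1 h2
      · simp [hg, h1, hne.symm]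
      · simp [hg, h2]
      · simp [hg, hφx, hφy, h1, h2, hinv v]
    · rw [hg]
      split_ifs with h1 h2
      · subst h1
        exact iff_of_false (fun e => huv (by rw [e])) fun e => (hfix u).1 hx ⟨v, e.symm⟩
      · subst h2
        exact iff_of_false (fun e => huv (by rw [← e, Sym2.eq_swap])) fun e =>
          (hfix u).1 hy ⟨v, e.symm⟩
      · rw [(hin u fun e => by rcases hsub u e with e | e <;> contradiction).1, hι.eq_iff]
    · exact iff_of_true (by rw [hg, if_pos rfl]) ((hfix x).1 hx)
    · exact iff_of_true (by rw [hg, if_pos rfl]) ((hfix y).1 hy)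
  · have hy := fun e => hx (hboth.2 e)
    have hne : ∀ v, φ v ≠ v := fun v hv => by
      rcases hsub v hv with rfl | rfl <;> contradiction
    refine ⟨φ, ⟨fun v => (hin v (hne v)).2.1, hinv⟩, fun u v _ => ?_, ?_, ?_⟩
    · rw [(hin u (hne u)).1, hι.eq_iff]
    · exact iff_of_false (fun e => (hin x (hne x)).2.2 (by rw [e])) (by rwa [← hfix])
    · exact iff_of_false (fun e => (hin x (hne x)).2.2 (by rw [e])) (by rwa [← hfix])

/-! ### Two-sums of graphs -/

/-- The disjoint union of `H` and `G`, together with an edge from `v` to `w` whenever `L v w`. -/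
def linkedSum {V W : Type*} (H : SimpleGraph V) (G : SimpleGraph W) (L : V → W → Prop) :
    SimpleGraph (V ⊕ W) where
  Adj
    | .inl u, .inl v => H.Adj u v
    | .inr u, .inr v => G.Adj u v
    | .inl u, .inr v => L u v
    | .inr u, .inl v => L v u
  symm := ⟨by
    rintro (u | u) (v | v) h
    exacts [H.adj_symm h, h, h, G.adj_symm h]⟩
  loopless := ⟨by
    rintro (u | u) h
    exacts [H.loopless.irrefl _ h, G.loopless.irrefl _ h]⟩

section linkedSum

variable {V W : Type*} {H : SimpleGraph V} {G : SimpleGraph W} {L : V → W → Prop}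

@[simp] lemma linkedSum_inl_inl {u v : V} : (H.linkedSum G L).Adj (.inl u) (.inl v) ↔ H.Adj u v :=
  .rfl

@[simp] lemma linkedSum_inr_inr {u v : W} : (H.linkedSum G L).Adj (.inr u) (.inr v) ↔ G.Adj u v :=
  .rfl

@[simp] lemma linkedSum_inl_inr {u : V} {v : W} :
    (H.linkedSum G L).Adj (.inl u) (.inr v) ↔ L u v :=
  .rfl

@[simp] lemma linkedSum_inr_inl {u : W} {v : V} :
    (H.linkedSum G L).Adj (.inr u) (.inl v) ↔ L v u :=
  .rfl

end linkedSum

lemma ncard_neighborSet_eq_of_map {V X : Type*} {H : SimpleGraph V} {K : SimpleGraph X} {v : V}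
    {a : X} (ψ : V → X) (hψ : Function.Injective ψ)
    (h : ∀ t, K.Adj a t ↔ ∃ u, H.Adj v u ∧ ψ u = t) :
    (K.neighborSet a).ncard = (H.neighborSet v).ncard := by
  rw [← Set.ncard_image_of_injective _ hψ]
  congr 1
  ext t
  exact h t

/-- The two-sum of `H` and `G` at the edges `xy` and `pq`: these edges are replaced by the edges
`xp` and `yq`. -/
def twoSum {V W : Type*} (H : SimpleGraph V) (x y : V) (G : SimpleGraph W) (p q : W) :
    SimpleGraph (V ⊕ W) :=
  (H.deleteEdges {s(x, y)}).linkedSum (G.deleteEdges {s(p, q)})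
    fun v w => v = x ∧ w = p ∨ v = y ∧ w = q

section twoSum

variable {V W : Type*} {H : SimpleGraph V} {G : SimpleGraph W} {x y : V} {p q : W}

lemma ncard_neighborSet_twoSum_inl (hxy : H.Adj x y) (v : V) :
    ((H.twoSum x y G p q).neighborSet (.inl v)).ncard = (H.neighborSet v).ncard := by
  classical
  have hne := hxy.ne
  have hyx := hxy.symm
  refine ncard_neighborSet_eq_of_map
    (fun u => if v = x ∧ u = y then .inr p else if v = y ∧ u = x then .inr q else .inl u) ?_ ?_
  · intro a b hab
    grind
  · rintro (t | t)
    · simp only [twoSum, linkedSum_inl_inl, deleteEdges_adj, Set.mem_singleton_iff, Sym2.eq_iff]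
      grind
    · simp only [twoSum, linkedSum_inl_inr]
      grind

lemma ncard_neighborSet_twoSum_inr (hpq : G.Adj p q) (w : W) :
    ((H.twoSum x y G p q).neighborSet (.inr w)).ncard = (G.neighborSet w).ncard := by
  classical
  have hne := hpq.ne
  have hqp := hpq.symm
  refine ncard_neighborSet_eq_of_map
    (fun u => if w = p ∧ u = q then .inl x else if w = q ∧ u = p then .inl y else .inr u) ?_ ?_
  · intro a b hab
    grind
  · rintro (t | t)
    · simp only [twoSum, linkedSum_inr_inl]
      grind
    · simp only [twoSum, linkedSum_inr_inr, deleteEdges_adj, Set.mem_singleton_iff, Sym2.eq_iff]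
      grind

lemma IsTwoEdgeConnectedCubic.twoSum (hH : H.IsTwoEdgeConnectedCubic)
    (hG : G.IsTwoEdgeConnectedCubic) (hxy : H.Adj x y) (hpq : G.Adj p q) :
    (H.twoSum x y G p q).IsTwoEdgeConnectedCubic := by
  have := hH.nonempty
  refine ⟨inferInstance, fun e => ?_, ?_⟩
  · have hl : ∀ a b, H.Adj a b → s(a, b) ≠ s(x, y) → s(Sum.inl a, Sum.inl b) ≠ e →
        ((H.twoSum x y G p q).deleteEdges {e}).Reachable (.inl a) (.inl b) :=
      fun a b hab h1 h2 => Adj.reachable <| by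
        rw [deleteEdges_adj, SimpleGraph.twoSum, linkedSum_inl_inl, deleteEdges_adj]
        exact ⟨⟨hab, h1⟩, h2⟩
    have hr : ∀ a b, G.Adj a b → s(a, b) ≠ s(p, q) → s(Sum.inr a, Sum.inr b) ≠ e →
        ((H.twoSum x y G p q).deleteEdges {e}).Reachable (.inr a) (.inr b) :=
      fun a b hab h1 h2 => Adj.reachable <| by
        rw [deleteEdges_adj, SimpleGraph.twoSum, linkedSum_inr_inr, deleteEdges_adj]
        exact ⟨⟨hab, h1⟩, h2⟩
    have hxp : s(Sum.inl x, Sum.inr p) ≠ e →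
        ((H.twoSum x y G p q).deleteEdges {e}).Reachable (.inl x) (.inr p) :=
      fun h => Adj.reachable (by simpa [SimpleGraph.twoSum] using h)
    have hyq : s(Sum.inl y, Sum.inr q) ≠ e →
        ((H.twoSum x y G p q).deleteEdges {e}).Reachable (.inl y) (.inr q) :=
      fun h => Adj.reachable (by simpa [SimpleGraph.twoSum] using h)
    -- Each summand stays connected without its edge `xy` or `pq`.
    have hl' : (∀ a b, s(Sum.inl a, Sum.inl b) ≠ e) → ∀ a b,
        ((H.twoSum x y G p q).deleteEdges {e}).Reachable (.inl a) (.inl b) := fun he a b =>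
      Reachable.lift Sum.inl (fun a b hab => by
        rw [deleteEdges_adj] at hab
        exact hl a b hab.1 hab.2 (he a b)) (hH.preconnected_deleteEdges s(x, y) a b)
    have hr' : (∀ a b, s(Sum.inr a, Sum.inr b) ≠ e) → ∀ a b,
        ((H.twoSum x y G p q).deleteEdges {e}).Reachable (.inr a) (.inr b) := fun he a b =>
      Reachable.lift Sum.inr (fun a b hab => by
        rw [deleteEdges_adj] at hab
        exact hr a b hab.1 hab.2 (he a b)) (hG.preconnected_deleteEdges s(p, q) a b)
    have main : (∀ a b, ((H.twoSum x y G p q).deleteEdges {e}).Reachable (.inl a) (.inl b)) ∧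
        (∀ a b, ((H.twoSum x y G p q).deleteEdges {e}).Reachable (.inr a) (.inr b)) ∧
        ∃ a b, ((H.twoSum x y G p q).deleteEdges {e}).Reachable (.inl a) (.inr b) := by
      by_cases h1 : ∃ a b, s(Sum.inl a, Sum.inl b) = e
      · obtain ⟨c, d, rfl⟩ := h1
        have hinr := hr' (by simp)
        refine ⟨fun a b => Reachable.lift Sum.inl (fun a b hab => ?_)
          (hH.preconnected_deleteEdges s(c, d) a b), hinr, x, p, hxp (by simp)⟩
        -- The edge `xy` is replaced by a path through the other summand.
        have hdetour := ((hxp (by simp)).trans (hinr p q)).trans (hyq (by simp)).symm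
        rw [deleteEdges_adj] at hab
        by_cases h : s(a, b) = s(x, y)
        · rw [Sym2.eq_iff] at h
          rcases h with ⟨rfl, rfl⟩ | ⟨rfl, rfl⟩
          exacts [hdetour, hdetour.symm]
        · refine hl a b hab.1 h fun h' => hab.2 ?_
          simpa using h'
      by_cases h2 : ∃ a b, s(Sum.inr a, Sum.inr b) = e
      · obtain ⟨c, d, rfl⟩ := h2
        have hinl := hl' (by simp)
        refine ⟨hinl, fun a b => Reachable.lift Sum.inr (fun a b hab => ?_)
          (hG.preconnected_deleteEdges s(c, d) a b), x, p, hxp (by simp)⟩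
        have hdetour := ((hxp (by simp)).symm.trans (hinl x y)).trans (hyq (by simp))
        rw [deleteEdges_adj] at hab
        by_cases h : s(a, b) = s(p, q)
        · rw [Sym2.eq_iff] at h
          rcases h with ⟨rfl, rfl⟩ | ⟨rfl, rfl⟩
          exacts [hdetour, hdetour.symm]
        · refine hr a b hab.1 h fun h' => hab.2 ?_
          simpa using h'
      push Not at h1 h2
      refine ⟨hl' h1, hr' h2, ?_⟩
      by_cases h : s(Sum.inl x, Sum.inr p) = e
      · exact ⟨y, q, hyq (by simp [← h, hxy.ne'])⟩
      · exact ⟨x, p, hxp h⟩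
    obtain ⟨hL, hR, a, b, hab⟩ := main
    rintro (u | u) (v | v)
    exacts [hL u v, ((hL u a).trans hab).trans (hR b v),
      ((hL v a).trans hab).trans (hR b u) |>.symm, hR u v]
  · rintro (v | w)
    · rw [ncard_neighborSet_twoSum_inl hxy, hH.ncard_neighborSet]
    · rw [ncard_neighborSet_twoSum_inr hpq, hG.ncard_neighborSet]

/-- A perfect matching of a two-sum induces perfect matchings of both summands, and the deleted
edge is used in both or in neither of them. -/
lemma IsMatchingMap.exists_restrict_twoSum [Finite V] [Finite W] (hV : Even (Nat.card V))
    (hW : Even (Nat.card W)) (hxy : H.Adj x y) (hpq : G.Adj p q) {m : V ⊕ W → V ⊕ W}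
    (hm : (H.twoSum x y G p q).IsMatchingMap m) :
    ∃ mH mG, H.IsMatchingMap mH ∧ G.IsMatchingMap mG ∧
      (∀ u v, s(u, v) ≠ s(x, y) → (mH u = v ↔ m (.inl u) = .inl v)) ∧
      (∀ u v, s(u, v) ≠ s(p, q) → (mG u = v ↔ m (.inr u) = .inr v)) ∧
      (mH x = y ↔ mG p = q) := by
  obtain ⟨mH, hH, hH', hHx, hHy⟩ := exists_isMatchingMap_restrict (ι := Sum.inl)
    Sum.inl_injective hm.involutive hxy hV (fun v => by
      have h := hm.adj (.inl v)
      cases hv : m (.inl v) with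
      | inl t =>
        rw [hv, SimpleGraph.twoSum, linkedSum_inl_inl, deleteEdges_adj] at h
        exact .inl ⟨t, rfl, h.1, h.2⟩
      | inr t =>
        rw [hv, SimpleGraph.twoSum, linkedSum_inl_inr] at h
        exact .inr ⟨h.imp And.left And.left, by simp⟩)
  obtain ⟨mG, hG, hG', hGp, hGq⟩ := exists_isMatchingMap_restrict (ι := Sum.inr)
    Sum.inr_injective hm.involutive hpq hW (fun v => by
      have h := hm.adj (.inr v)
      cases hv : m (.inr v) with
      | inr t =>
        rw [hv, SimpleGraph.twoSum, linkedSum_inr_inr, deleteEdges_adj] at h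
        exact .inl ⟨t, rfl, h.1, h.2⟩
      | inl t =>
        rw [hv, SimpleGraph.twoSum, linkedSum_inr_inl] at h
        exact .inr ⟨h.imp And.right And.right, by simp⟩)
  refine ⟨mH, mG, hH, hG, hH', hG', ?_⟩
  -- If `x` is matched outside of its summand, then by `xp`; if `p` is, then also by `xp`.
  have hx := hm.adj (.inl x)
  have hp := hm.adj (.inr p)
  rw [hHx, hGp]
  cases h : m (.inl x) with
  | inr t =>
    rw [h, SimpleGraph.twoSum, linkedSum_inl_inr] at hx
    have ht : t = p := by
      rcases hx with hx | hx
      exacts [hx.2, absurd hx.1 hxy.ne]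
    subst ht
    rw [← h, hm.involutive, h]
    simp
  | inl t =>
    refine iff_of_false (by simp) fun h' => ?_
    cases h'' : m (.inr p) with
    | inr s => exact h' (by simp [h''])
    | inl s =>
      rw [h'', SimpleGraph.twoSum, linkedSum_inr_inl] at hp
      have hs : s = x := by
        rcases hp with hp | hp
        exacts [hp.1, absurd hp.2 hpq.ne]
      subst hs
      rw [← h'', hm.involutive] at h
      cases h

end twoSum

/-! ### Prescribing an edge in both matchings -/

/-- Every finite cubic graph that stays connected after deleting any one edge has an `S₄`-pair. -/
def S4MapConjecture : Prop :=
  ∀ (V : Type u) [Finite V] (G : SimpleGraph V), G.IsTwoEdgeConnectedCubic →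
    ∃ m₁ m₂, G.IsS4MapPair ∅ m₁ m₂

/-- If no `S₄`-pair of `G` has the edge `pq` in its intersection, then any set `S` of edges of a
graph `H` can be kept out of the intersection of two perfect matchings, at the price of ignoring the
odd cycles through `S`: put a copy of `G` without `pq` into each edge of `S`. -/
lemma exists_isS4MapPair_avoiding (hS4 : S4MapConjecture.{u}) {W : Type u} [Finite W]
    {G : SimpleGraph W} (hG : G.IsTwoEdgeConnectedCubic) {p q : W} (hpq : G.Adj p q)
    (hno : ∀ m₁ m₂, G.IsS4MapPair ∅ m₁ m₂ → ¬ (m₁ p = q ∧ m₂ p = q)) (n : ℕ) :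
    ∀ (V : Type u) [Finite V] (H : SimpleGraph V), H.IsTwoEdgeConnectedCubic →
      ∀ S : Finset (Sym2 V), (S : Set (Sym2 V)) ⊆ H.edgeSet → S.card = n →
      ∃ m₁ m₂, H.IsS4MapPair S m₁ m₂ ∧ ∀ u v, s(u, v) ∈ S → ¬ (m₁ u = v ∧ m₂ u = v) := by
  classical
  induction n with
  | zero =>
    intro V _ H hH S _ hcard
    obtain rfl := Finset.card_eq_zero.1 hcard
    obtain ⟨m₁, m₂, h⟩ := hS4 V H hH
    exact ⟨m₁, m₂, by simpa using h, by simp⟩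
  | succ n ih =>
    intro V _ H hH S hS hcard
    obtain ⟨f, T, hfT, rfl, hT⟩ := Finset.card_eq_succ.1 hcard
    induction f with | _ x y
    have hxy : H.Adj x y := hS (Finset.mem_insert_self _ _)
    obtain ⟨m₁, m₂, h, hdisj⟩ := ih (V ⊕ W) (H.twoSum x y G p q) (hH.twoSum hG hxy hpq)
      (T.image (Sym2.map Sum.inl)) (by
        intro e he
        simp only [Finset.coe_image, Set.mem_image] at he
        obtain ⟨e, he, rfl⟩ := he
        induction e with | _ a b
        rw [Sym2.map_mk, mem_edgeSet, twoSum, linkedSum_inl_inl, deleteEdges_adj]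
        exact ⟨hS (Finset.mem_insert_of_mem he), fun h => hfT (h ▸ he)⟩)
      (by rw [Finset.card_image_of_injective _ (Sym2.map.injective Sum.inl_injective), hT])
    obtain ⟨_, _, hmV⟩ := hS4 V H hH
    obtain ⟨_, _, hmW⟩ := hS4 W G hG
    have hV := hmV.left.even_card
    have hW := hmW.left.even_card
    obtain ⟨a₁, b₁, ha₁, hb₁, hra₁, hrb₁, hf₁⟩ := h.left.exists_restrict_twoSum hV hW hxy hpq
    obtain ⟨a₂, b₂, ha₂, hb₂, hra₂, hrb₂, hf₂⟩ := h.right.exists_restrict_twoSum hV hW hxy hpq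
    obtain ⟨c, hc⟩ := h.bipartite
    -- Two matchings of `H` with `xy` in common would come with an `S₄`-pair of `G` containing `pq`.
    have hf : ¬ (a₁ x = y ∧ a₂ x = y) := by
      rw [hf₁, hf₂]
      rintro ⟨h1, h2⟩
      refine hno b₁ b₂ ⟨hb₁, hb₂, fun w => c (.inr w), fun u v huv hu hv _ => ?_⟩ ⟨h1, h2⟩
      have hne : s(u, v) ≠ s(p, q) := by
        rw [Ne, Sym2.eq_iff]
        rintro (⟨rfl, rfl⟩ | ⟨rfl, rfl⟩)
        exacts [hu h1, hu (hb₁.eq_comm.1 h1)]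
      refine hc _ _ ?_ (mt (hrb₁ u v hne).2 hu) (mt (hrb₂ u v hne).2 hv) ?_
      · rw [twoSum, linkedSum_inr_inr, deleteEdges_adj]
        exact ⟨huv, hne⟩
      · simp only [Finset.coe_image, Set.mem_image, not_exists, not_and]
        intro e _
        induction e with | _ a b
        simp
    refine ⟨a₁, a₂, ⟨ha₁, ha₂, fun v => c (.inl v), fun u v huv hu hv hmem => ?_⟩,
      fun u v huv huv' => ?_⟩
    · simp only [Finset.coe_insert, Set.mem_insert_iff, not_or] at hmem
      refine hc _ _ ?_ (mt (hra₁ u v hmem.1).2 hu) (mt (hra₂ u v hmem.1).2 hv) ?_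
      · rw [twoSum, linkedSum_inl_inl, deleteEdges_adj]
        exact ⟨huv, hmem.1⟩
      · simp only [Finset.coe_image, Set.mem_image, not_exists, not_and]
        intro e he h'
        rw [← Sym2.map_mk, (Sym2.map.injective Sum.inl_injective).eq_iff] at h'
        exact hmem.2 (h' ▸ he)
    · by_cases hne : s(u, v) = s(x, y)
      · rw [Sym2.eq_iff] at hne
        rcases hne with ⟨rfl, rfl⟩ | ⟨rfl, rfl⟩
        · exact hf huv'
        · exact hf ⟨ha₁.eq_comm.1 huv'.1, ha₂.eq_comm.1 huv'.2⟩
      · refine hdisj (.inl u) (.inl v) ?_ ⟨(hra₁ u v hne).1 huv'.1, (hra₂ u v hne).1 huv'.2⟩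
        exact Finset.mem_image.2 ⟨s(u, v), (Finset.mem_insert.1 huv).resolve_left hne, rfl⟩

/-! ### The Petersen graph -/

/-- The three neighbours of each vertex of the Petersen graph. -/
def petersenNeighbors : Fin 10 → Fin 3 → Fin 10 :=
  ![![1, 4, 5], ![0, 2, 6], ![1, 3, 7], ![2, 4, 8], ![3, 0, 9],
    ![0, 7, 8], ![1, 8, 9], ![2, 9, 5], ![3, 5, 6], ![4, 6, 7]]

/-- The Petersen graph: the outer 5-cycle has the vertices `0, …, 4`, the vertex `i` is joined to
the inner vertex `5 + i`, and `5 + i` is joined to `5 + (i + 2)`, with `i + 2` taken modulo `5`. -/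
def petersen : SimpleGraph (Fin 10) where
  Adj u v := ∃ i, petersenNeighbors u i = v
  symm := ⟨by decide⟩
  loopless := ⟨by decide⟩

instance : DecidableRel petersen.Adj := fun u v => by
  unfold petersen
  infer_instance

lemma petersen_ncard_neighborSet (v : Fin 10) : (petersen.neighborSet v).ncard = 3 := by
  rw [← Nat.card_coe_set_eq, Nat.card_eq_fintype_card, card_neighborSet_eq_degree]
  revert v
  decide

/-- A cycle of length nine through all vertices of the Petersen graph other than `1`, as a
`9`-periodic sequence. -/
def petersenCycle (i : ℕ) : Fin 10 := ![0, 5, 8, 6, 9, 7, 2, 3, 4] (Fin.ofNat 9 i)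

lemma petersenCycle_adj : ∀ i < 9, petersen.Adj (petersenCycle i) (petersenCycle (i + 1)) := by
  decide

lemma petersenCycle_edge_injective : ∀ i < 9, ∀ j < 9,
    s(petersenCycle i, petersenCycle (i + 1)) = s(petersenCycle j, petersenCycle (j + 1)) →
      i = j := by
  decide

lemma exists_petersenCycle_eq : ∀ v : Fin 10, v ≠ 1 → ∃ i ≤ 9, petersenCycle i = v := by
  decide

lemma petersen_isTwoEdgeConnectedCubic : petersen.IsTwoEdgeConnectedCubic := by
  refine ⟨inferInstance, fun e => ?_, petersen_ncard_neighborSet⟩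
  have hcycle : ∀ v, v ≠ 1 → (petersen.deleteEdges {e}).Reachable 0 v := fun v hv => by
    obtain ⟨i, hi, rfl⟩ := exists_petersenCycle_eq v hv
    exact reachable_deleteEdges_of_closed_trail petersenCycle petersenCycle_adj rfl
      petersenCycle_edge_injective e hi
  have hone : (petersen.deleteEdges {e}).Reachable 0 1 := by
    by_cases h : s((0 : Fin 10), 1) = e
    · refine (hcycle 2 (by decide)).trans (Adj.reachable ?_)
      rw [deleteEdges_adj, ← h]
      exact ⟨by decide, by simp only [Set.mem_singleton_iff]; decide⟩
    · refine Adj.reachable ?_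
      rw [deleteEdges_adj]
      exact ⟨by decide, h⟩
  have hall : ∀ v, (petersen.deleteEdges {e}).Reachable 0 v := fun v => by
    by_cases hv : v = 1
    · exact hv ▸ hone
    · exact hcycle v hv
  exact fun u v => (hall u).symm.trans (hall v)

lemma IsTwoEdgeConnectedCubic.comap_equiv {V W : Type*} {G : SimpleGraph V}
    (hG : G.IsTwoEdgeConnectedCubic) (f : W ≃ V) : (G.comap f).IsTwoEdgeConnectedCubic := by
  have := hG.nonempty
  refine ⟨f.nonempty, fun e a b => ?_, fun w => ?_⟩
  · have h := Reachable.lift (K := (G.comap f).deleteEdges {e}) f.symm (fun a b hab => ?_)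
      (hG.preconnected_deleteEdges (e.map f) (f a) (f b))
    · simpa using h
    · rw [deleteEdges_adj] at hab
      refine Adj.reachable ?_
      rw [deleteEdges_adj]
      refine ⟨by simpa using hab.1, fun h => hab.2 ?_⟩
      rw [Set.mem_singleton_iff] at h ⊢
      simp [← h]
  · rw [← hG.ncard_neighborSet (f w)]
    refine ncard_neighborSet_eq_of_map f.symm f.symm.injective fun t => ?_
    rw [comap_adj]
    exact ⟨fun h => ⟨f t, h, by simp⟩, by rintro ⟨u, hu, rfl⟩; simpa using hu⟩

lemma IsMatchingMap.petersen_cases {m : Fin 10 → Fin 10} (hm : petersen.IsMatchingMap m)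
    (v : Fin 10) : m v = petersenNeighbors v 0 ∨ m v = petersenNeighbors v 1 ∨
      m v = petersenNeighbors v 2 := by
  have h := hm.adj v
  simp only [petersen, Fin.exists_fin_succ] at h
  grind

/-- The Petersen graph has no two disjoint perfect matchings. -/
lemma exists_eq_of_isMatchingMap_petersen {m m' : Fin 10 → Fin 10}
    (hm : petersen.IsMatchingMap m) (hm' : petersen.IsMatchingMap m') : ∃ v, m v = m' v := by
  by_contra! hne
  have h := hm.petersen_cases
  have h' := hm'.petersen_cases
  have hi := fun u v => (hm.eq_comm (u := u) (v := v)).1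
  have hi' := fun u v => (hm'.eq_comm (u := u) (v := v)).1
  simp only [Fin.forall_fin_succ] at h h' hne
  simp [petersenNeighbors] at h h' hne
  clear hm hm'
  grind (splits := 40)

/-- Under the `S₄`-Conjecture, every edge is contained in both matchings of some `S₄`-pair.
Otherwise all edges of the Petersen graph could be kept out of the intersection of two perfect
matchings. -/
lemma exists_isS4MapPair_inter (hS4 : S4MapConjecture.{u}) {V : Type u} [Finite V]
    {G : SimpleGraph V} (hG : G.IsTwoEdgeConnectedCubic) {p q : V} (hpq : G.Adj p q) :
    ∃ m₁ m₂, G.IsS4MapPair ∅ m₁ m₂ ∧ m₁ p = q ∧ m₂ p = q := by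
  classical
  by_contra! hno
  let P : SimpleGraph (ULift.{u} (Fin 10)) := petersen.comap Equiv.ulift
  obtain ⟨m₁, m₂, h, hdisj⟩ := exists_isS4MapPair_avoiding hS4 hG hpq
    (fun m₁ m₂ h h' => hno m₁ m₂ h h'.1 h'.2) _ (ULift.{u} (Fin 10)) P
    (petersen_isTwoEdgeConnectedCubic.comap_equiv _) P.edgeFinset (by simp) rfl
  have hdown : ∀ m, P.IsMatchingMap m → petersen.IsMatchingMap fun v => (m ⟨v⟩).down :=
    fun m hm => ⟨fun v => hm.adj ⟨v⟩, fun v => congrArg ULift.down (hm.involutive ⟨v⟩)⟩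
  obtain ⟨v, hv⟩ := exists_eq_of_isMatchingMap_petersen (hdown _ h.left) (hdown _ h.right)
  exact hdisj ⟨v⟩ (m₁ ⟨v⟩) (mem_edgeFinset.2 (h.left.adj _)) ⟨rfl, ULift.down_injective hv.symm⟩

/-! ### Separating two matchings at a vertex -/

/-- The Petersen graph without the adjacent vertices `0` and `1`. -/
abbrev petersenGadget : SimpleGraph (Fin 8) := petersen.comap fun i => i.succ.succ

/-- The graph `G` with its vertex `w` expanded to the Petersen graph without the vertex `1`. The
vertex `w` takes the place of the vertex `0`, and the edges from `w` to its neighbours `x` and `y`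
are attached to the other two neighbours `2` and `6` of the vertex `1` instead. The remaining
vertices `2, …, 9` appear as the elements `0, …, 7` of `Fin 8`. -/
def petersenExpansion {V : Type*} (G : SimpleGraph V) (w x y : V) : SimpleGraph (V ⊕ Fin 8) :=
  (G.deleteEdges {s(w, x), s(w, y)}).linkedSum petersenGadget fun v i =>
    v = x ∧ i = 0 ∨ v = y ∧ i = 4 ∨ v = w ∧ (i = 2 ∨ i = 3)

section petersenExpansion

variable {V : Type*} {G : SimpleGraph V} {w x y : V}

lemma petersenExpansion_inl_inl {u v : V} : (G.petersenExpansion w x y).Adj (.inl u) (.inl v) ↔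
    G.Adj u v ∧ s(u, v) ≠ s(w, x) ∧ s(u, v) ≠ s(w, y) := by
  simp [petersenExpansion]

lemma petersenExpansion_inl_inr {v : V} {i : Fin 8} :
    (G.petersenExpansion w x y).Adj (.inl v) (.inr i) ↔
      v = x ∧ i = 0 ∨ v = y ∧ i = 4 ∨ v = w ∧ (i = 2 ∨ i = 3) :=
  .rfl

lemma petersenExpansion_inr_inl {v : V} {i : Fin 8} :
    (G.petersenExpansion w x y).Adj (.inr i) (.inl v) ↔
      v = x ∧ i = 0 ∨ v = y ∧ i = 4 ∨ v = w ∧ (i = 2 ∨ i = 3) :=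
  .rfl

lemma petersenExpansion_inr_inr {i j : Fin 8} :
    (G.petersenExpansion w x y).Adj (.inr i) (.inr j) ↔ petersenGadget.Adj i j :=
  .rfl

lemma ncard_neighborSet_petersenExpansion_inl (hx : G.Adj w x) (hy : G.Adj w y) (hxy : x ≠ y)
    (v : V) : ((G.petersenExpansion w x y).neighborSet (.inl v)).ncard =
      (G.neighborSet v).ncard := by
  classical
  have hwx := hx.ne
  have hwy := hy.ne
  have hx' := hx.symm
  have hy' := hy.symm
  refine ncard_neighborSet_eq_of_map (fun u =>
    if v = w ∧ u = x then .inr 2 else if v = w ∧ u = y then .inr 3 else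
    if v = x ∧ u = w then .inr 0 else if v = y ∧ u = w then .inr 4 else .inl u) ?_ ?_
  · intro a b hab
    grind (splits := 20)
  · rintro (t | t)
    · simp only [petersenExpansion_inl_inl, ne_eq, Sym2.eq_iff]
      grind
    · simp only [petersenExpansion_inl_inr]
      grind

/-- The map from the Petersen graph to the expansion that sends the vertex `0` to `w`, the vertex
`1` to a given vertex `t`, and each further vertex to its copy. -/
def petersenEmbedding (w t : V) : Fin 10 → V ⊕ Fin 8 :=
  Fin.cons (.inl w) (Fin.cons (.inl t) Sum.inr)

@[simp] lemma petersenEmbedding_zero (w t : V) : petersenEmbedding w t 0 = .inl w := rfl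

@[simp] lemma petersenEmbedding_one (w t : V) : petersenEmbedding w t 1 = .inl t := rfl

@[simp] lemma petersenEmbedding_succ_succ (w t : V) (i : Fin 8) :
    petersenEmbedding w t i.succ.succ = .inr i := rfl

lemma petersenEmbedding_injective {t : V} (h : w ≠ t) :
    Function.Injective (petersenEmbedding w t) := by
  rw [petersenEmbedding, Fin.cons_injective_iff, Fin.cons_injective_iff]
  refine ⟨?_, by simp, Sum.inr_injective⟩
  rintro ⟨i, hi⟩
  induction i using Fin.cases with
  | zero => exact h (Sum.inl_injective hi).symm
  | succ i => simp at hi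

lemma petersen_adj_succ_succ_zero : ∀ i : Fin 8, petersen.Adj i.succ.succ 0 ↔ i = 2 ∨ i = 3 := by
  decide

lemma petersen_adj_succ_succ_one : ∀ i : Fin 8, petersen.Adj i.succ.succ 1 ↔ i = 0 ∨ i = 4 := by
  decide

lemma ncard_neighborSet_petersenExpansion_inr (hx : G.Adj w x) (hy : G.Adj w y)
    (i : Fin 8) : ((G.petersenExpansion w x y).neighborSet (.inr i)).ncard = 3 := by
  classical
  have hwx := hx.ne
  have hwy := hy.ne
  rw [← petersen_ncard_neighborSet i.succ.succ]
  -- Vertex `1` of the Petersen graph stands for `x` as a neighbour of `2`, and for `y` otherwise.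
  refine ncard_neighborSet_eq_of_map (petersenEmbedding w (if i = 0 then x else y))
    (petersenEmbedding_injective (by split_ifs <;> assumption)) ?_
  rintro (t | t)
  · rw [petersenExpansion_inr_inl, Fin.exists_fin_succ, Fin.exists_fin_succ, Fin.succ_zero_eq_one]
    simp only [petersen_adj_succ_succ_zero, petersen_adj_succ_succ_one, petersenEmbedding_zero,
      petersenEmbedding_one, petersenEmbedding_succ_succ, reduceCtorEq, and_false, exists_false,
      or_false, Sum.inl.injEq]
    grind
  · rw [petersenExpansion_inr_inr, Fin.exists_fin_succ, Fin.exists_fin_succ, Fin.succ_zero_eq_one]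
    simp

lemma petersenExpansion_adj_petersenEmbedding (t : V) {a b : Fin 10} (hab : petersen.Adj a b)
    (ha : a ≠ 1) (hb : b ≠ 1) :
    (G.petersenExpansion w x y).Adj (petersenEmbedding w t a) (petersenEmbedding w t b) := by
  have hcases : ∀ c : Fin 10, c ≠ 1 → c = 0 ∨ ∃ i : Fin 8, i.succ.succ = c := by decide
  rcases hcases a ha with rfl | ⟨i, rfl⟩ <;> rcases hcases b hb with rfl | ⟨j, rfl⟩
  · exact absurd rfl hab.ne
  · rw [petersenEmbedding_zero, petersenEmbedding_succ_succ, petersenExpansion_inl_inr]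
    exact .inr (.inr ⟨rfl, (petersen_adj_succ_succ_zero j).1 hab.symm⟩)
  · rw [petersenEmbedding_zero, petersenEmbedding_succ_succ, petersenExpansion_inr_inl]
    exact .inr (.inr ⟨rfl, (petersen_adj_succ_succ_zero i).1 hab⟩)
  · exact hab

lemma IsTwoEdgeConnectedCubic.petersenExpansion (hG : G.IsTwoEdgeConnectedCubic)
    (hx : G.Adj w x) (hy : G.Adj w y) (hxy : x ≠ y) :
    (G.petersenExpansion w x y).IsTwoEdgeConnectedCubic := by
  refine ⟨⟨.inl w⟩, fun e => ?_, ?_⟩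
  · -- All vertices of the Petersen graph but `1` lie on a common cycle of the expansion.
    have hcycle : ∀ i, ((G.petersenExpansion w x y).deleteEdges {e}).Reachable
        (.inl w) (.inr i) := fun i => by
      have hne : ∀ i < 10, petersenCycle i ≠ 1 := by decide
      obtain ⟨k, hk, hk'⟩ := exists_petersenCycle_eq i.succ.succ (by revert i; decide)
      have h := reachable_deleteEdges_of_closed_trail (K := G.petersenExpansion w x y) (n := 9)
        (fun k => petersenEmbedding w x (petersenCycle k))
        (fun k hk => petersenExpansion_adj_petersenEmbedding x (petersenCycle_adj k hk)
          (hne k (by omega)) (hne (k + 1) (by omega))) rfl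
        (fun j hj k hk h => petersenCycle_edge_injective j hj k hk <| by
          rw [← Sym2.map_mk, ← Sym2.map_mk] at h
          exact Sym2.map.injective (petersenEmbedding_injective hx.ne) h) e hk
      rwa [hk'] at h
    -- The edge `e'` of `G` becomes `e`, if there is such an edge.
    obtain ⟨e', h1, h2, h3⟩ : ∃ e' : Sym2 V,
        (∀ a b, s(a, b) ≠ e' → s(Sum.inl a, Sum.inl b) ≠ e) ∧
        (s(w, x) ≠ e' → s(Sum.inr 0, Sum.inl x) ≠ e) ∧
        (s(w, y) ≠ e' → s(Sum.inr 4, Sum.inl y) ≠ e) := by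
      by_cases h2 : s(Sum.inr 0, Sum.inl x) = e
      · exact ⟨s(w, x), by simp [← h2], by simp, by simp [← h2]⟩
      by_cases h3 : s(Sum.inr 4, Sum.inl y) = e
      · exact ⟨s(w, y), by simp [← h3], by simp [← h3], by simp⟩
      by_cases h1 : ∃ a b, s(Sum.inl a, Sum.inl b) = e
      · obtain ⟨a, b, rfl⟩ := h1
        exact ⟨s(a, b), by simp, by simp, by simp⟩
      · push Not at h1
        exact ⟨s(w, w), fun a b _ => h1 a b, fun _ => h2, fun _ => h3⟩
    have hwx : s(w, x) ≠ e' → ((G.petersenExpansion w x y).deleteEdges {e}).Reachable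
        (.inl w) (.inl x) := fun h => (hcycle 0).trans <| Adj.reachable <| by
      rw [deleteEdges_adj, petersenExpansion_inr_inl]
      exact ⟨.inl ⟨rfl, rfl⟩, h2 h⟩
    have hwy : s(w, y) ≠ e' → ((G.petersenExpansion w x y).deleteEdges {e}).Reachable
        (.inl w) (.inl y) := fun h => (hcycle 4).trans <| Adj.reachable <| by
      rw [deleteEdges_adj, petersenExpansion_inr_inl]
      exact ⟨.inr (.inl ⟨rfl, rfl⟩), h3 h⟩
    have hinl : ∀ a b, ((G.petersenExpansion w x y).deleteEdges {e}).Reachable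
        (.inl a) (.inl b) := fun a b =>
      Reachable.lift Sum.inl (fun a b hab => by
        rw [deleteEdges_adj, Set.mem_singleton_iff] at hab
        by_cases h4 : s(a, b) = s(w, x)
        · have h := hwx (h4 ▸ hab.2)
          rw [Sym2.eq_iff] at h4
          rcases h4 with ⟨rfl, rfl⟩ | ⟨rfl, rfl⟩
          exacts [h, h.symm]
        by_cases h5 : s(a, b) = s(w, y)
        · have h := hwy (h5 ▸ hab.2)
          rw [Sym2.eq_iff] at h5
          rcases h5 with ⟨rfl, rfl⟩ | ⟨rfl, rfl⟩
          exacts [h, h.symm]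
        refine Adj.reachable ?_
        rw [deleteEdges_adj, petersenExpansion_inl_inl]
        exact ⟨⟨hab.1, h4, h5⟩, h1 a b hab.2⟩) (hG.preconnected_deleteEdges e' a b)
    have hall : ∀ u, ((G.petersenExpansion w x y).deleteEdges {e}).Reachable (.inl w) u := by
      rintro (u | u)
      exacts [hinl w u, hcycle u]
    exact fun u v => (hall u).symm.trans (hall v)
  · rintro (v | i)
    · rw [ncard_neighborSet_petersenExpansion_inl hx hy hxy, hG.ncard_neighborSet]
    · exact ncard_neighborSet_petersenExpansion_inr hx hy i

/-- A perfect matching of the expansion that contains the edge from `w` to the vertex `3` of the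
gadget is determined on the gadget by the one of `x` and `y` that it joins to the gadget. -/
lemma IsMatchingMap.petersenExpansion_cases {m : V ⊕ Fin 8 → V ⊕ Fin 8}
    (hm : (G.petersenExpansion w x y).IsMatchingMap m) (hw : m (.inl w) = .inr 3) :
    (m (.inr 0) = .inl x ∧ m (.inr 1) = .inr 2 ∧ m (.inr 6) = .inr 4 ∧ m (.inr 7) = .inr 5) ∨
    (m (.inr 4) = .inl y ∧ m (.inr 0) = .inr 5 ∧ m (.inr 1) = .inr 6 ∧ m (.inr 2) = .inr 7) := by
  have hadj : ∀ i j, petersenGadget.Adj i j → j ∈ (![{1, 5}, {0, 2, 6}, {1, 7}, {5, 6}, {7, 6},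
    {0, 3, 7}, {1, 4, 3}, {2, 5, 4}] : Fin 8 → Finset (Fin 8)) i := by decide
  have h : ∀ i, (∃ v, (v = x ∧ i = 0 ∨ v = y ∧ i = 4 ∨ v = w ∧ (i = 2 ∨ i = 3)) ∧
      m (.inr i) = .inl v) ∨ ∃ j, j ∈ (![{1, 5}, {0, 2, 6}, {1, 7}, {5, 6}, {7, 6},
      {0, 3, 7}, {1, 4, 3}, {2, 5, 4}] : Fin 8 → Finset (Fin 8)) i ∧ m (.inr i) = .inr j :=
    fun i => by
      have hi := hm.adj (.inr i)
      cases hv : m (.inr i) with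
      | inl v => exact .inl ⟨v, by rwa [hv, petersenExpansion_inr_inl] at hi, rfl⟩
      | inr j => exact .inr ⟨j, hadj i j (by rwa [hv] at hi), rfl⟩
  have hi := fun u v => (hm.eq_comm (u := u) (v := v)).1
  have h0 := h 0
  have h1 := h 1
  have h2 := h 2
  have h4 := h 4
  have h5 := h 5
  have h6 := h 6
  have h7 := h 7
  simp [or_and_right, exists_or] at h0 h1 h2 h4 h5 h6 h7
  clear hm hadj h
  grind (splits := 40)

/-- In each of the two cases of `IsMatchingMap.petersenExpansion_cases`, the edges outside of the
matching contain a 5-cycle of the gadget. Hence the two matchings of an `S₄`-pair are not in the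
same case. -/
lemma IsS4MapPair.petersenExpansion_cases {m₁ m₂ : V ⊕ Fin 8 → V ⊕ Fin 8}
    (h : (G.petersenExpansion w x y).IsS4MapPair ∅ m₁ m₂) (hw₁ : m₁ (.inl w) = .inr 3)
    (hw₂ : m₂ (.inl w) = .inr 3) :
    (m₁ (.inr 0) = .inl x ∧ m₁ (.inr 4) ≠ .inl y ∧ m₂ (.inr 4) = .inl y ∧ m₂ (.inr 0) ≠ .inl x) ∨
    (m₂ (.inr 0) = .inl x ∧ m₂ (.inr 4) ≠ .inl y ∧ m₁ (.inr 4) = .inl y ∧ m₁ (.inr 0) ≠ .inl x) := by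
  obtain ⟨c, hc⟩ := h.bipartite
  have hi₁ := fun u v => (h.left.eq_comm (u := u) (v := v)).1
  have hi₂ := fun u v => (h.right.eq_comm (u := u) (v := v)).1
  have hc' : ∀ i j, petersenGadget.Adj i j → m₁ (.inr i) ≠ .inr j → m₂ (.inr i) ≠ .inr j →
      c (.inr i) ≠ c (.inr j) := fun i j hij h₁ h₂ => hc _ _ hij h₁ h₂ (by simp)
  have hodd : ∀ a b c d e : Bool, a ≠ b → b ≠ c → c ≠ d → d ≠ e → e ≠ a → False := by
    rintro (_ | _) (_ | _) (_ | _) (_ | _) (_ | _) <;> simp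
  have h₁ := h.left.petersenExpansion_cases hw₁
  have h₂ := h.right.petersenExpansion_cases hw₂
  clear hc h
  rcases h₁ with h₁ | h₁ <;> rcases h₂ with h₂ | h₂
  · exact (hodd _ _ _ _ _ (hc' 3 5 (by decide) (by grind) (by grind))
      (hc' 5 0 (by decide) (by grind) (by grind)) (hc' 0 1 (by decide) (by grind) (by grind))
      (hc' 1 6 (by decide) (by grind) (by grind))
      (hc' 6 3 (by decide) (by grind) (by grind))).elim
  · exact .inl ⟨h₁.1, by grind, h₂.1, by grind⟩
  · exact .inr ⟨h₂.1, by grind, h₁.1, by grind⟩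
  · exact (hodd _ _ _ _ _ (hc' 3 5 (by decide) (by grind) (by grind))
      (hc' 5 7 (by decide) (by grind) (by grind)) (hc' 7 4 (by decide) (by grind) (by grind))
      (hc' 4 6 (by decide) (by grind) (by grind))
      (hc' 6 3 (by decide) (by grind) (by grind))).elim

/-- A perfect matching of the expansion that joins `w` to the gadget, and no vertex of `G` other
than `w` and its neighbour `t`, induces a perfect matching of `G` through the edge `wt`. -/
lemma IsMatchingMap.exists_restrict_petersenExpansion [Finite V] {m : V ⊕ Fin 8 → V ⊕ Fin 8}
    (hm : (G.petersenExpansion w x y).IsMatchingMap m) (hV : Even (Nat.card V)) {t : V}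
    (ht : G.Adj w t) (htxy : t = x ∨ t = y) (hw : m (.inl w) = .inr 3)
    (h : ∀ v i, m (.inl v) = .inr i → v = w ∨ v = t) :
    ∃ m', G.IsMatchingMap m' ∧ m' w = t ∧
      ∀ u v, s(u, v) ≠ s(w, t) → (m' u = v ↔ m (.inl u) = .inl v) := by
  obtain ⟨m', hm', h1, h2, -⟩ := exists_isMatchingMap_restrict (H := G) (ι := Sum.inl)
    Sum.inl_injective hm.involutive ht hV (fun v => by
      have hadj := hm.adj (.inl v)
      cases hv : m (.inl v) with
      | inl u =>
        rw [hv, petersenExpansion_inl_inl] at hadj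
        refine .inl ⟨u, rfl, hadj.1, ?_⟩
        rcases htxy with rfl | rfl
        exacts [hadj.2.1, hadj.2.2]
      | inr i => exact .inr ⟨h v i hv, by simp⟩)
  exact ⟨m', hm', h2.2 (by simp [hw]), h1⟩

/-- Under the `S₄`-Conjecture, for any two edges `wx` and `wy` at a vertex `w` there is an `S₄`-pair
whose first matching contains `wx` and whose second one contains `wy`: restrict an `S₄`-pair of the
expansion that has the edge from `w` to the vertex `3` of the gadget in both matchings. -/
lemma exists_isS4MapPair_separate (hS4 : S4MapConjecture.{u}) {V : Type u} [Finite V]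
    {G : SimpleGraph V} (hG : G.IsTwoEdgeConnectedCubic) {w x y : V} (hx : G.Adj w x)
    (hy : G.Adj w y) (hxy : x ≠ y) :
    ∃ m₁ m₂, G.IsS4MapPair ∅ m₁ m₂ ∧ m₁ w = x ∧ m₂ w = y := by
  obtain ⟨m₁, m₂, h, hw₁, hw₂⟩ := exists_isS4MapPair_inter hS4
    (hG.petersenExpansion hx hy hxy) (p := .inl w) (q := .inr 3)
    (petersenExpansion_inl_inr.2 (by simp))
  obtain ⟨_, _, hmV⟩ := hS4 V G hG
  have hV := hmV.left.even_card
  have hout : ∀ m, (G.petersenExpansion w x y).IsMatchingMap m → m (.inl w) = .inr 3 →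
      ∀ v i, m (.inl v) = .inr i → v = w ∨ v = x ∧ m (.inr 0) = .inl x ∨
        v = y ∧ m (.inr 4) = .inl y := fun m hm hw v i hv => by
    have hadj := hm.adj (.inl v)
    have hv' := hm.eq_comm.1 hv
    rw [hv, petersenExpansion_inl_inr] at hadj
    grind
  -- The two orders in which the matchings may leave the gadget are symmetric.
  have main : ∀ m₁ m₂, (G.petersenExpansion w x y).IsS4MapPair ∅ m₁ m₂ → m₁ (.inl w) = .inr 3 →
      m₂ (.inl w) = .inr 3 → m₁ (.inr 4) ≠ .inl y → m₂ (.inr 0) ≠ .inl x →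
      ∃ m₁ m₂, G.IsS4MapPair ∅ m₁ m₂ ∧ m₁ w = x ∧ m₂ w = y := by
    intro m₁ m₂ h hw₁ hw₂ h₁ h₂
    obtain ⟨a₁, ha₁, hax, hr₁⟩ := h.left.exists_restrict_petersenExpansion hV hx (.inl rfl) hw₁
      fun v i hv => by
        rcases hout _ h.left hw₁ v i hv with h | h | h
        exacts [.inl h, .inr h.1, absurd h.2 h₁]
    obtain ⟨a₂, ha₂, hay, hr₂⟩ := h.right.exists_restrict_petersenExpansion hV hy (.inr rfl) hw₂
      fun v i hv => by
        rcases hout _ h.right hw₂ v i hv with h | h | h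
        exacts [.inl h, absurd h.2 h₂, .inr h.1]
    obtain ⟨c, hc⟩ := h.bipartite
    refine ⟨a₁, a₂, ⟨ha₁, ha₂, fun v => c (.inl v), fun u v huv hu hv _ => ?_⟩, hax, hay⟩
    have hnx : s(u, v) ≠ s(w, x) := by
      rw [Ne, Sym2.eq_iff]
      rintro (⟨rfl, rfl⟩ | ⟨rfl, rfl⟩)
      exacts [hu hax, hu (ha₁.eq_comm.1 hax)]
    have hny : s(u, v) ≠ s(w, y) := by
      rw [Ne, Sym2.eq_iff]
      rintro (⟨rfl, rfl⟩ | ⟨rfl, rfl⟩)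
      exacts [hv hay, hv (ha₂.eq_comm.1 hay)]
    exact hc _ _ (petersenExpansion_inl_inl.2 ⟨huv, hnx, hny⟩) (mt (hr₁ u v hnx).2 hu)
      (mt (hr₂ u v hny).2 hv) (by simp)
  rcases h.petersenExpansion_cases hw₁ hw₂ with ⟨_, h1, _, h2⟩ | ⟨_, h1, _, h2⟩
  · exact main m₁ m₂ h hw₁ hw₂ h1 h2
  · exact main m₂ m₁ h.symm hw₂ hw₁ h1 h2

end petersenExpansion

/-! ### The equivalence -/

lemma S4Conjecture.s4MapConjecture (h : S4Conjecture.{u}) : S4MapConjecture.{u} := by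
  classical
  intro V _ G hG
  have := Fintype.ofFinite V
  obtain ⟨M₁, M₂, hM⟩ := h V G ((isBridgelessCubic_iff G).2 hG)
  exact hM.exists_maps

lemma S4Conjecture.s4VertexFrequencyConjecture (h : S4Conjecture.{u}) :
    S4VertexFrequencyConjecture.{u} := by
  classical
  intro V _ G _ hG w a b c ha hb hc hab hac hbc i hi j hj k hk hsum
  have hS4 := h.s4MapConjecture
  rw [isBridgelessCubic_iff] at hG
  have hedge : ∀ e ∈ G.incidenceSet w, ∃ v, G.Adj w v ∧ e = s(w, v) := by
    rintro e ⟨he, hwe⟩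
    obtain ⟨v, rfl⟩ := hwe
    exact ⟨v, he, rfl⟩
  obtain ⟨x, hx, rfl⟩ := hedge a ha
  obtain ⟨y, hy, rfl⟩ := hedge b hb
  obtain ⟨z, hz, rfl⟩ := hedge c hc
  have hxy : x ≠ y := fun h => hab (by rw [h])
  have hxz : x ≠ z := fun h => hac (by rw [h])
  have hyz : y ≠ z := fun h => hbc (by rw [h])
  suffices ∃ m₁ m₂, G.IsS4MapPair ∅ m₁ m₂ ∧
      ((if m₁ w = x then 1 else 0) + if m₂ w = x then 1 else 0) = i ∧
      ((if m₁ w = y then 1 else 0) + if m₂ w = y then 1 else 0) = j ∧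
      ((if m₁ w = z then 1 else 0) + if m₂ w = z then 1 else 0) = k by
    obtain ⟨m₁, m₂, hm, hijk⟩ := this
    refine ⟨_, _, hm.isS4Pair, ?_⟩
    rwa [hm.edgeFrequency, hm.edgeFrequency, hm.edgeFrequency]
  have hcases : (i = 2 ∧ j = 0 ∧ k = 0) ∨ (i = 0 ∧ j = 2 ∧ k = 0) ∨ (i = 0 ∧ j = 0 ∧ k = 2) ∨
      (i = 1 ∧ j = 1 ∧ k = 0) ∨ (i = 1 ∧ j = 0 ∧ k = 1) ∨ (i = 0 ∧ j = 1 ∧ k = 1) := by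
    omega
  rcases hcases with ⟨rfl, rfl, rfl⟩ | ⟨rfl, rfl, rfl⟩ | ⟨rfl, rfl, rfl⟩ | ⟨rfl, rfl, rfl⟩ |
    ⟨rfl, rfl, rfl⟩ | ⟨rfl, rfl, rfl⟩
  · obtain ⟨m₁, m₂, hm, h₁, h₂⟩ := exists_isS4MapPair_inter hS4 hG hx
    exact ⟨m₁, m₂, hm, by simp [h₁, h₂, hxy, hxz]⟩
  · obtain ⟨m₁, m₂, hm, h₁, h₂⟩ := exists_isS4MapPair_inter hS4 hG hy
    exact ⟨m₁, m₂, hm, by simp [h₁, h₂, hxy.symm, hyz]⟩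
  · obtain ⟨m₁, m₂, hm, h₁, h₂⟩ := exists_isS4MapPair_inter hS4 hG hz
    exact ⟨m₁, m₂, hm, by simp [h₁, h₂, hxz.symm, hyz.symm]⟩
  · obtain ⟨m₁, m₂, hm, h₁, h₂⟩ := exists_isS4MapPair_separate hS4 hG hx hy hxy
    exact ⟨m₁, m₂, hm, by simp [h₁, h₂, hxy, hxy.symm, hxz, hyz]⟩
  · obtain ⟨m₁, m₂, hm, h₁, h₂⟩ := exists_isS4MapPair_separate hS4 hG hx hz hxz
    exact ⟨m₁, m₂, hm, by simp [h₁, h₂, hxy, hxz, hxz.symm, hyz.symm]⟩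
  · obtain ⟨m₁, m₂, hm, h₁, h₂⟩ := exists_isS4MapPair_separate hS4 hG hy hz hyz
    exact ⟨m₁, m₂, hm, by simp [h₁, h₂, hxy.symm, hxz.symm, hyz, hyz.symm]⟩

lemma S4VertexFrequencyConjecture.s4Conjecture (h : S4VertexFrequencyConjecture.{u}) :
    S4Conjecture.{u} := by
  intro V _ G _ hG
  obtain ⟨w⟩ := hG.connected.nonempty
  have hcard := ((isBridgelessCubic_iff G).1 hG).ncard_neighborSet w
  obtain ⟨x, y, z, hxy, hxz, hyz, hN⟩ := Set.ncard_eq_three.1 hcard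
  have hmem : ∀ v ∈ G.neighborSet w, s(w, v) ∈ G.incidenceSet w := fun v hv =>
    ⟨hv, Sym2.mem_mk_left w v⟩
  obtain ⟨M₁, M₂, hM, -⟩ := h V G hG w s(w, x) s(w, y) s(w, z)
    (hmem x (by simp [hN])) (hmem y (by simp [hN])) (hmem z (by simp [hN]))
    (mt Sym2.congr_right.1 hxy) (mt Sym2.congr_right.1 hxz) (mt Sym2.congr_right.1 hyz)
    2 (by simp) 0 (by simp) 0 (by simp) rfl
  exact ⟨M₁, M₂, hM⟩

end SimpleGraph

theorem mainTheorem6 :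
    SimpleGraph.S4VertexFrequencyConjecture.{u} ↔ SimpleGraph.S4Conjecture.{u} :=
  ⟨fun h => h.s4Conjecture, fun h => h.s4VertexFrequencyConjecture⟩
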